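/- Let $A\in\mathbb R^{m\times n}$ be any matrix. For $b\in\mathbb R^m$ and $\lambda>0$ let $$S(b,\lambda):=\operatorname*{argmin}_{x\in\mathbb R^n}\Big\{\tfrac12\|Ax-b\|^2+\lambda\|x\|_1\Big\}\subseteq\mathbb R^n$$ be the set of all minimizers of the LASSO problem, where $\|\cdot\|$ denotes the Euclidean norm and $\|x\|_1=\sum_{i=1}^n|x_i|$. Then $S$ is globally (Hausdorff) Lipschitz continuous on $\mathbb R^m\times\mathbb R_{++}$, where $\mathbb R_{++}=(0,\infty)$: the set $S(b,\lambda)$ is nonempty for all $(b,\lambda)\in\mathbb R^m\times\mathbb R_{++}$, and there is a constant $\kappa\in(0,\infty)$ (depending only on $A$) such that $$d_H\big(S(b,\lambda),S(b',\lambda')\big)\le\kappa\,\|(b,\lambda)-(b',\lambda')\|\qquad\text{for all }(b,\lambda),(b',\lambda')\in\mathbb R^m\times\mathbb R_{++}.$$ Here $d_H(C,D)=\max\{\sup_{x\in C}d(x,D),\ \sup_{x\in D}d(x,C)\}$ is the Hausdorff distance with respect to the Euclidean distance, and $\|(b,\lambda)\|=(\|b\|^2+\lambda^2)^{1/2}$.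 No uniqueness of minimizers is assumed. -/

import Mathlib

/-- The domain `{p | F p ≠ ∅}` of a set-valued mapping `F`. -/
def setValuedDom {P Q : Type*} (F : P → Set Q) : Set P :=
  {p | (F p).Nonempty}

/-- The set-valued mapping `F` is (Hausdorff) Lipschitz continuous relative to `D ⊆ dom F`: for a
constant `κ ∈ (0, ∞)`, `d_H (F p, F q) ≤ κ ‖p - q‖` for all `p, q ∈ D`. The Hausdorff distance is
the extended one, so that the inequality entails its finiteness. -/
def HausdorffLipschitzOn {P Q : Type*} [NormedAddCommGroup P] [NormedAddCommGroup Q]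
    (F : P → Set Q) (D : Set P) : Prop :=
  D ⊆ setValuedDom F ∧ ∃ κ : ℝ, 0 < κ ∧ ∀ p ∈ D, ∀ q ∈ D,
    Metric.hausdorffEDist (F p) (F q) ≤ ENNReal.ofReal (κ * ‖p - q‖)

/-- The parameter space `ℝ^m × ℝ` of pairs `(b, λ)`, with its Euclidean norm. -/
abbrev LassoParam (m : ℕ) : Type :=
  WithLp 2 (EuclideanSpace ℝ (Fin m) × ℝ)

/-- The LASSO objective `x ↦ ½ ‖A x - b‖² + l ‖x‖₁`. -/
noncomputable def lassoObjective {m n : ℕ} (A : Matrix (Fin m) (Fin n) ℝ)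
    (b : EuclideanSpace ℝ (Fin m)) (l : ℝ) (x : EuclideanSpace ℝ (Fin n)) : ℝ :=
  1 / 2 * ‖WithLp.toLp 2 (A.mulVec x.ofLp) - b‖ ^ 2 + l * ∑ i, |x i|

/-- The solution mapping of the LASSO: it sends `(b, λ)` to the set of all global minimizers
of the objective. -/
def lassoSolution {m n : ℕ} (A : Matrix (Fin m) (Fin n) ℝ) (p : LassoParam m) :
    Set (EuclideanSpace ℝ (Fin n)) :=
  {x | ∀ y, lassoObjective A p.fst p.snd x ≤ lassoObjective A p.fst p.snd y}

/-! If `x'` is a minimizer for `q`, every `y` with `A y = A x'` and `‖y‖₁ ≤ ‖x'‖₁` is one too. These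
conditions form a linear system whose matrix depends only on `A`, so Hoffman's bound
(`exists_hoffman_constant`) moves a minimizer for `p` into this set at a cost proportional to the
change in `A x` and `‖x‖₁`. Since `‖x‖₁` is least on the fibre of `A x`, a second use of Hoffman
controls it by `A x`. Adding the variational inequalities for both parameters then bounds the change
in `A x`, with no factor `1/λ`. -/

/-- Finitely many lower bounds and finitely many upper bounds that are pairwise compatible, also
with the end points of an interval, admit a common point in that interval. -/
lemma exists_mem_Icc_between {P N : Type*} [Finite N] (L : N → ℝ) (U : P → ℝ) {lo hi : ℝ}
    (h : lo ≤ hi) (hLU : ∀ j i, L j ≤ U i) (hL : ∀ j, L j ≤ hi) (hU : ∀ i, lo ≤ U i) :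
    ∃ y, lo ≤ y ∧ y ≤ hi ∧ (∀ j, L j ≤ y) ∧ ∀ i, y ≤ U i := by
  have hbdd : BddAbove (insert lo (Set.range L)) := ((Set.finite_range L).insert lo).bddAbove
  have hne : (insert lo (Set.range L)).Nonempty := Set.insert_nonempty _ _
  refine ⟨sSup (insert lo (Set.range L)), le_csSup hbdd (Set.mem_insert _ _), csSup_le hne ?_,
    fun j => le_csSup hbdd (Set.mem_insert_of_mem _ ⟨j, rfl⟩), fun i => csSup_le hne ?_⟩
  · rintro _ (rfl | ⟨j, rfl⟩)
    exacts [h, hL j]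
  · rintro _ (rfl | ⟨j, rfl⟩)
    exacts [hU i, hLU j i]

lemma abs_dotProduct_sub_le {n : ℕ} (a x y : Fin n → ℝ) {s : ℝ} (h : ∀ k, |y k - x k| ≤ s) :
    |a ⬝ᵥ y - a ⬝ᵥ x| ≤ (∑ k, |a k|) * s := by
  rw [← dotProduct_sub, dotProduct, Finset.sum_mul]
  refine (Finset.abs_sum_le_sum_abs _ _).trans (Finset.sum_le_sum fun k _ => ?_)
  rw [abs_mul]
  exact mul_le_mul_of_nonneg_left (h k) (abs_nonneg _)

/-- **Hoffman's error bound**, proved by Fourier-Motzkin elimination: a point violating a feasible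
system of linear inequalities by at most `r` lies within `κ * r` of a solution, where `κ` does not
depend on the right-hand side. -/
theorem exists_hoffman_constant (n : ℕ) : ∀ {ι : Type} [Finite ι] (a : ι → Fin n → ℝ),
    ∃ κ : ℝ, 0 ≤ κ ∧ ∀ c : ι → ℝ, (∃ z, ∀ i, a i ⬝ᵥ z ≤ c i) → ∀ (x : Fin n → ℝ) (r : ℝ), 0 ≤ r →
      (∀ i, a i ⬝ᵥ x ≤ c i + r) →
      ∃ y, (∀ i, a i ⬝ᵥ y ≤ c i) ∧ ∀ k, |y k - x k| ≤ κ * r := by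
  induction n with
  | zero =>
    intro ι _ a
    refine ⟨0, le_rfl, fun c ⟨z, hz⟩ x r _ _ => ⟨z, hz, fun k => k.elim0⟩⟩
  | succ n ih =>
    intro ι _ a
    have := Fintype.ofFinite ι
    set α : ι → ℝ := fun i => a i 0 with hα
    set w : ι → Fin n → ℝ := fun i => Fin.tail (a i) with hw
    have hdot : ∀ i (t : ℝ) (v : Fin n → ℝ), a i ⬝ᵥ (Fin.cons t v : Fin (n + 1) → ℝ)
        = α i * t + w i ⬝ᵥ v := by
      intro i t v
      simp [dotProduct, Fin.sum_univ_succ, hα, hw, Fin.tail]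
    set D : ℝ := ∑ i, |(α i)⁻¹| with hD
    have hD0 : 0 ≤ D := Finset.sum_nonneg fun i _ => abs_nonneg _
    have hDle : ∀ i, |(α i)⁻¹| ≤ D := fun i =>
      Finset.single_le_sum (f := fun i => |(α i)⁻¹|) (fun i _ => abs_nonneg _) (Finset.mem_univ i)
    set M : ℝ := ∑ i, ∑ k, |w i k| with hM
    have hM0 : 0 ≤ M := Finset.sum_nonneg fun i _ => Finset.sum_nonneg fun k _ => abs_nonneg _
    have hMle : ∀ i, ∑ k, |w i k| ≤ M := fun i =>
      Finset.single_le_sum (f := fun i => ∑ k, |w i k|)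
        (fun i _ => Finset.sum_nonneg fun k _ => abs_nonneg _) (Finset.mem_univ i)
    -- The system with the first variable eliminated: each pair row says that a lower bound on that
    -- variable is at most an upper bound.
    let row : {i // α i = 0} ⊕ ({i // 0 < α i} × {i // α i < 0}) → Fin n → ℝ :=
      Sum.elim (fun i => w i.1) (fun p => (α p.1.1)⁻¹ • w p.1.1 - (α p.2.1)⁻¹ • w p.2.1)
    obtain ⟨κ, hκ, H⟩ := ih row
    -- Dividing both rows of a pair by their leading coefficients turns a violation `r` into at most
    -- `2 * D * r`; the `1` serves rows with `α i = 0`.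
    set C : ℝ := 1 + 2 * D with hC
    have hC0 : 0 ≤ C := by positivity
    set K : ℝ := D * (1 + M * (κ * C)) with hK
    have hK0 : 0 ≤ K := by positivity
    refine ⟨κ * C + K, by positivity, fun c ⟨z, hz⟩ x r hr hx => ?_⟩
    obtain ⟨z0, z, rfl⟩ : ∃ t v, z = Fin.cons t v := ⟨_, _, (Fin.cons_self_tail z).symm⟩
    obtain ⟨x0, x, rfl⟩ : ∃ t v, x = Fin.cons t v := ⟨_, _, (Fin.cons_self_tail x).symm⟩
    simp only [hdot] at hz hx ⊢
    -- dividing an inequality by its leading coefficient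
    have hup : ∀ {i : ι} {s q d : ℝ}, 0 < α i → α i * s + q ≤ d →
        s ≤ (α i)⁻¹ * d - (α i)⁻¹ * q := by
      intro i s q d hi h
      have := mul_le_mul_of_nonneg_left h (inv_pos.2 hi).le
      rw [mul_add, inv_mul_cancel_left₀ hi.ne'] at this
      linarith
    have hlow : ∀ {i : ι} {s q d : ℝ}, α i < 0 → α i * s + q ≤ d →
        (α i)⁻¹ * d - (α i)⁻¹ * q ≤ s := by
      intro i s q d hi h
      have := mul_le_mul_of_nonpos_left h (inv_lt_zero.2 hi).le
      rw [mul_add, inv_mul_cancel_left₀ hi.ne] at this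
      linarith
    have hDr : ∀ i (s : ℝ), |s| ≤ r → |(α i)⁻¹ * s| ≤ D * r := fun i s hs => by
      rw [abs_mul]; exact mul_le_mul (hDle i) hs (abs_nonneg _) hD0
    have hrr : |r| ≤ r := (abs_of_nonneg hr).le
    obtain ⟨y, hy, hyx⟩ := H
      (Sum.elim (fun i => c i.1) (fun p => (α p.1.1)⁻¹ * c p.1.1 - (α p.2.1)⁻¹ * c p.2.1))
      ⟨z, by
        rintro (⟨i, hi⟩ | ⟨⟨i, hi⟩, ⟨j, hj⟩⟩)
        · have := hz i
          simp only [row, Sum.elim_inl]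
          rw [hi] at this
          linarith
        · simp only [row, Sum.elim_inr, sub_dotProduct, smul_dotProduct, smul_eq_mul]
          linarith [hup hi (hz i), hlow hj (hz j)]⟩
      x (C * r) (by positivity) (by
        rintro (⟨i, hi⟩ | ⟨⟨i, hi⟩, ⟨j, hj⟩⟩)
        · have := hx i
          simp only [row, Sum.elim_inl]
          rw [hi] at this
          have : 0 ≤ D * r := by positivity
          rw [hC]
          linarith
        · simp only [row, Sum.elim_inr, sub_dotProduct, smul_dotProduct, smul_eq_mul]
          have h1 := hup hi (hx i)
          have h2 := hlow hj (hx j)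
          have h3 := abs_le.1 (hDr i r hrr)
          have h4 := abs_le.1 (hDr j r hrr)
          rw [hC]
          linarith)
    have hdiff : ∀ i, |w i ⬝ᵥ y - w i ⬝ᵥ x| ≤ M * (κ * C) * r := fun i => by
      refine (abs_dotProduct_sub_le (w i) x y hyx).trans ?_
      calc _ ≤ M * (κ * (C * r)) := mul_le_mul_of_nonneg_right (hMle i) (by positivity)
        _ = _ := by ring
    have hgap : ∀ i, |(α i)⁻¹ * (r - (w i ⬝ᵥ x - w i ⬝ᵥ y))| ≤ K * r := fun i => by
      rw [abs_mul, hK, mul_assoc]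
      refine mul_le_mul (hDle i) ?_ (abs_nonneg _) hD0
      have h1 := abs_le.1 (hdiff i)
      exact abs_le.2 ⟨by linarith, by linarith⟩
    have hKr : 0 ≤ K * r := by positivity
    -- The pair rows make the bounds on the first coordinate compatible; by `hgap`, `x0` violates
    -- each by at most `K * r`.
    obtain ⟨y0, h1, h2, h3, h4⟩ := exists_mem_Icc_between
      (fun j : {i // α i < 0} => (α j.1)⁻¹ * c j.1 - (α j.1)⁻¹ * (w j.1 ⬝ᵥ y))
      (fun i : {i // 0 < α i} => (α i.1)⁻¹ * c i.1 - (α i.1)⁻¹ * (w i.1 ⬝ᵥ y))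
      (lo := x0 - K * r) (hi := x0 + K * r) (by linarith)
      (by
        intro j i
        have := hy (Sum.inr (i, j))
        simp only [row, Sum.elim_inr, sub_dotProduct, smul_dotProduct, smul_eq_mul] at this
        linarith)
      (by
        rintro ⟨j, hj⟩
        have h1 := hlow hj (hx j)
        have h2 := abs_le.1 (hgap j)
        simp only
        linarith)
      (by
        rintro ⟨i, hi⟩
        have h1 := hup hi (hx i)
        have h2 := abs_le.1 (hgap i)
        simp only
        linarith)
    refine ⟨Fin.cons y0 y, fun i => ?_, fun k => ?_⟩
    · rw [hdot]
      rcases lt_trichotomy (α i) 0 with hi | hi | hi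
      · have := mul_le_mul_of_nonpos_left (h3 ⟨i, hi⟩) hi.le
        simp only [mul_sub, mul_inv_cancel_left₀ hi.ne] at this
        linarith
      · have := hy (Sum.inl ⟨i, hi⟩)
        simp only [row, Sum.elim_inl] at this
        rw [hi]
        linarith
      · have := mul_le_mul_of_nonneg_left (h4 ⟨i, hi⟩) hi.le
        simp only [mul_sub, mul_inv_cancel_left₀ hi.ne'] at this
        linarith
    · have hκr : 0 ≤ κ * C * r := by positivity
      refine Fin.cases ?_ (fun k => ?_) k
      · simp only [Fin.cons_zero]
        exact abs_le.2 ⟨by linarith, by linarith⟩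
      · simp only [Fin.cons_succ]
        linarith [hyx k]

/-! ### Error bound for the `ℓ¹` system -/

/-- Presents the `ℓ¹` ball as a finite system of linear inequalities, as Hoffman's bound requires.
-/
lemma sum_abs_le_iff_forall_sign {n : ℕ} (x : Fin n → ℝ) (t : ℝ) :
    ∑ k, |x k| ≤ t ↔ ∀ s : Fin n → SignType, (fun k => (s k : ℝ)) ⬝ᵥ x ≤ t := by
  constructor
  · intro h s
    refine le_trans (Finset.sum_le_sum fun k _ => ?_) h
    rcases h : s k with _ | _ | _
    · simp [h]
    · simpa [h] using neg_le_abs (x k)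
    · simpa [h] using le_abs_self (x k)
  · intro h
    have := h fun k => SignType.sign (x k)
    simpa [dotProduct, sign_mul_self] using this

/-- Error bound for the system `A y = A x'`, `‖y‖₁ ≤ ‖x'‖₁`. -/
lemma exists_l1_error_bound {m n : ℕ} (A : Matrix (Fin m) (Fin n) ℝ) :
    ∃ κ : ℝ, 0 ≤ κ ∧ ∀ (x x' : Fin n → ℝ) (r : ℝ), 0 ≤ r →
      (∀ j, |A.mulVec x j - A.mulVec x' j| ≤ r) → ∑ k, |x k| ≤ ∑ k, |x' k| + r →
      ∃ y, A.mulVec y = A.mulVec x' ∧ ∑ k, |y k| ≤ ∑ k, |x' k| ∧ ∀ k, |y k - x k| ≤ κ * r := by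
  obtain ⟨κ, hκ, H⟩ := exists_hoffman_constant n
    (Sum.elim (Sum.elim (fun j => A j) (fun j => -A j)) (fun (s : Fin n → SignType) k => (s k : ℝ)))
  refine ⟨κ, hκ, fun x x' r hr hA hs => ?_⟩
  have hrow : ∀ j v, A j ⬝ᵥ v = A.mulVec v j := fun _ _ => rfl
  obtain ⟨y, hy, hyx⟩ := H
    (Sum.elim (Sum.elim (A.mulVec x') (-A.mulVec x')) (fun _ => ∑ k, |x' k|))
    ⟨x', by
      rintro ((j | j) | s)
      · simp [hrow]
      · simp [hrow]
      · exact (sum_abs_le_iff_forall_sign _ _).1 le_rfl s⟩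
    x r hr (by
      rintro ((j | j) | s)
      · simp only [Sum.elim_inl, hrow]
        linarith [(abs_le.1 (hA j)).2]
      · simp only [Sum.elim_inl, Sum.elim_inr, neg_dotProduct, hrow, Pi.neg_apply]
        linarith [(abs_le.1 (hA j)).1]
      · exact (sum_abs_le_iff_forall_sign _ _).1 hs s)
  refine ⟨y, funext fun j => le_antisymm ?_ ?_,
    (sum_abs_le_iff_forall_sign _ _).2 fun s => hy (Sum.inr s), hyx⟩
  · simpa [hrow] using hy (Sum.inl (Sum.inl j))
  · simpa [hrow] using hy (Sum.inl (Sum.inr j))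

/-! ### Existence and optimality of minimizers -/

lemma EuclideanSpace.norm_le_sum_abs {n : ℕ} (x : EuclideanSpace ℝ (Fin n)) :
    ‖x‖ ≤ ∑ k, |x k| := by
  rw [EuclideanSpace.norm_eq]
  refine Real.sqrt_le_iff.2 ⟨Finset.sum_nonneg fun k _ => abs_nonneg _, ?_⟩
  exact Finset.sum_sq_le_sq_sum_of_nonneg fun k _ => abs_nonneg _

lemma continuous_lassoObjective {m n : ℕ} (A : Matrix (Fin m) (Fin n) ℝ)
    (b : EuclideanSpace ℝ (Fin m)) (l : ℝ) : Continuous (lassoObjective A b l) := by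
  have : Continuous fun x : EuclideanSpace ℝ (Fin n) => WithLp.toLp 2 (A.mulVec x.ofLp) :=
    (Matrix.toLpLin 2 2 A).continuous_of_finiteDimensional
  unfold lassoObjective
  fun_prop

lemma lassoSolution_nonempty {m n : ℕ} (A : Matrix (Fin m) (Fin n) ℝ) {p : LassoParam m}
    (hp : 0 < p.snd) : (lassoSolution A p).Nonempty := by
  refine (continuous_lassoObjective A p.fst p.snd).exists_forall_le
    (Filter.tendsto_atTop_mono (fun x => ?_)
      ((tendsto_norm_cocompact_atTop (E := EuclideanSpace ℝ (Fin n))).const_mul_atTop hp))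
  have := mul_le_mul_of_nonneg_left (EuclideanSpace.norm_le_sum_abs x) hp.le
  unfold lassoObjective
  nlinarith [sq_nonneg ‖WithLp.toLp 2 (A.mulVec x.ofLp) - p.fst‖]

lemma sum_abs_le_of_mem_lassoSolution {m n : ℕ} {A : Matrix (Fin m) (Fin n) ℝ} {p : LassoParam m}
    (hp : 0 < p.snd) {x y : EuclideanSpace ℝ (Fin n)} (hx : x ∈ lassoSolution A p)
    (hxy : A.mulVec y.ofLp = A.mulVec x.ofLp) : ∑ k, |x k| ≤ ∑ k, |y k| := by
  have := hx y
  unfold lassoObjective at this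
  rw [hxy] at this
  exact le_of_mul_le_mul_left (by linarith) hp

/-- The variational inequality satisfied by the minimizers. -/
lemma lassoSolution_variational {m n : ℕ} {A : Matrix (Fin m) (Fin n) ℝ} {p : LassoParam m}
    (hp : 0 < p.snd) {x : EuclideanSpace ℝ (Fin n)} (hx : x ∈ lassoSolution A p)
    (y : EuclideanSpace ℝ (Fin n)) :
    0 ≤ inner ℝ (WithLp.toLp 2 (A.mulVec x.ofLp) - p.fst)
        (WithLp.toLp 2 (A.mulVec y.ofLp) - WithLp.toLp 2 (A.mulVec x.ofLp))
      + p.snd * (∑ k, |y k| - ∑ k, |x k|) := by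
  set u := WithLp.toLp 2 (A.mulVec x.ofLp) with hu
  set v := WithLp.toLp 2 (A.mulVec y.ofLp) with hv
  -- Minimality against a point of the segment from `x` to `y`, convexity of `‖·‖₁`, and division by
  -- `t`.
  have key : ∀ t : ℝ, 0 < t → t < 1 → 0 ≤ inner ℝ (u - p.fst) (v - u)
      + p.snd * (∑ k, |y k| - ∑ k, |x k|) + t * (1 / 2 * ‖v - u‖ ^ 2) := by
    intro t ht ht1
    have h := hx (x + t • (y - x))
    unfold lassoObjective at h
    have h1 : WithLp.toLp 2 (A.mulVec (x + t • (y - x)).ofLp) - p.fst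
        = (u - p.fst) + t • (v - u) := by
      rw [WithLp.ofLp_add, WithLp.ofLp_smul, WithLp.ofLp_sub, Matrix.mulVec_add,
        Matrix.mulVec_smul, Matrix.mulVec_sub, WithLp.toLp_add, WithLp.toLp_smul, WithLp.toLp_sub]
      abel
    have h2 : ∑ k, |(x + t • (y - x)) k| ≤ (1 - t) * ∑ k, |x k| + t * ∑ k, |y k| := by
      rw [Finset.mul_sum, Finset.mul_sum, ← Finset.sum_add_distrib]
      refine Finset.sum_le_sum fun k _ => ?_
      calc |(x + t • (y - x)) k| = |(1 - t) * x k + t * y k| := by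
            congr 1; simp; ring
        _ ≤ |(1 - t) * x k| + |t * y k| := abs_add_le _ _
        _ = _ := by rw [abs_mul, abs_mul, abs_of_pos ht, abs_of_pos (sub_pos.2 ht1)]
    rw [h1, norm_add_sq_real, inner_smul_right, norm_smul, mul_pow, Real.norm_eq_abs, sq_abs] at h
    have h3 := mul_le_mul_of_nonneg_left h2 hp.le
    refine nonneg_of_mul_nonneg_right (?_ : 0 ≤ t * _) ht
    nlinarith
  by_contra! hneg
  set e := inner ℝ (u - p.fst) (v - u) + p.snd * (∑ k, |y k| - ∑ k, |x k|)
  have hlim : Filter.Tendsto (fun t : ℝ => e + t * (1 / 2 * ‖v - u‖ ^ 2))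
      (nhdsWithin 0 (Set.Ioi 0)) (nhds e) := by
    have : Continuous fun t : ℝ => e + t * (1 / 2 * ‖v - u‖ ^ 2) := by fun_prop
    simpa using (this.tendsto 0).mono_left nhdsWithin_le_nhds
  refine hneg.not_ge (ge_of_tendsto hlim ?_)
  filter_upwards [Ioo_mem_nhdsGT (zero_lt_one (α := ℝ))] with t ht using key t ht.1 ht.2

/-! ### Lipschitz estimates -/

/-- The `ℓ¹`-norm of a LASSO minimizer `x` depends on `A x` in a Lipschitz continuous way. -/
lemma exists_sum_abs_le_add_norm_mulVec_sub {m n : ℕ} (A : Matrix (Fin m) (Fin n) ℝ) :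
    ∃ C : ℝ, 0 ≤ C ∧ ∀ p : LassoParam m, 0 < p.snd → ∀ x ∈ lassoSolution A p,
      ∀ x' : EuclideanSpace ℝ (Fin n), ∑ k, |x k| ≤ ∑ k, |x' k|
        + C * ‖WithLp.toLp 2 (A.mulVec x.ofLp) - WithLp.toLp 2 (A.mulVec x'.ofLp)‖ := by
  obtain ⟨κ, hκ, H⟩ := exists_l1_error_bound A
  refine ⟨n * κ, by positivity, fun p hp x hx x' => ?_⟩
  set r := ‖WithLp.toLp 2 (A.mulVec x.ofLp) - WithLp.toLp 2 (A.mulVec x'.ofLp)‖ with hr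
  -- A small `d` with `A d = A (x - x')`, so that `x' + d` competes with `x` on the same fibre.
  obtain ⟨d, hd, -, hdle⟩ := H 0 (x.ofLp - x'.ofLp) r (norm_nonneg _)
    (fun j => by
      have := PiLp.norm_apply_le
        (WithLp.toLp 2 (A.mulVec x.ofLp) - WithLp.toLp 2 (A.mulVec x'.ofLp)) j
      simpa [Matrix.mulVec_sub, abs_sub_comm] using this)
    (by
      simp only [Pi.zero_apply, abs_zero, Finset.sum_const_zero]
      have : 0 ≤ ∑ k, |(x.ofLp - x'.ofLp) k| := Finset.sum_nonneg fun k _ => abs_nonneg _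
      have := norm_nonneg
        (WithLp.toLp 2 (A.mulVec x.ofLp) - WithLp.toLp 2 (A.mulVec x'.ofLp))
      linarith)
  have h := sum_abs_le_of_mem_lassoSolution hp hx (y := WithLp.toLp 2 (x'.ofLp + d)) (by
    simp [Matrix.mulVec_add, hd, Matrix.mulVec_sub])
  refine h.trans ?_
  calc ∑ k, |x' k + d k| ≤ ∑ k, (|x' k| + κ * r) := Finset.sum_le_sum fun k _ =>
        (abs_add_le _ _).trans (add_le_add_right (by simpa using hdle k) _)
    _ = _ := by simp [Finset.sum_add_distrib]; ring

/-- `A x` is Lipschitz continuous in the parameter, where `x` is a LASSO minimizer. -/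
lemma norm_mulVec_sub_le_of_mem_lassoSolution {m n : ℕ} {A : Matrix (Fin m) (Fin n) ℝ} {C : ℝ}
    (hC0 : 0 ≤ C) (hC : ∀ p : LassoParam m, 0 < p.snd → ∀ x ∈ lassoSolution A p,
      ∀ x' : EuclideanSpace ℝ (Fin n), ∑ k, |x k| ≤ ∑ k, |x' k|
        + C * ‖WithLp.toLp 2 (A.mulVec x.ofLp) - WithLp.toLp 2 (A.mulVec x'.ofLp)‖)
    {p q : LassoParam m} (hp : 0 < p.snd) (hq : 0 < q.snd)
    {x x' : EuclideanSpace ℝ (Fin n)} (hx : x ∈ lassoSolution A p) (hx' : x' ∈ lassoSolution A q) :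
    ‖WithLp.toLp 2 (A.mulVec x.ofLp) - WithLp.toLp 2 (A.mulVec x'.ofLp)‖
      ≤ ‖p.fst - q.fst‖ + C * |p.snd - q.snd| := by
  have h1 := lassoSolution_variational hp hx x'
  have h2 := lassoSolution_variational hq hx' x
  have h3 := hC p hp x hx x'
  have h4 := hC q hq x' hx' x
  set u := WithLp.toLp 2 (A.mulVec x.ofLp)
  set v := WithLp.toLp 2 (A.mulVec x'.ofLp)
  rw [norm_sub_rev v u] at h4
  have h5 : |(∑ k, |x' k|) - (∑ k, |x k|)| ≤ C * ‖u - v‖ :=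
    abs_le.2 ⟨by linarith, by linarith⟩
  have h6 : (p.snd - q.snd) * (∑ k, |x' k| - ∑ k, |x k|) ≤ |p.snd - q.snd| * (C * ‖u - v‖) :=
    (le_abs_self _).trans
      ((abs_mul _ _).trans_le (mul_le_mul_of_nonneg_left h5 (abs_nonneg _)))
  -- The quadratic term makes the sum of the two inequalities strongly monotone in `A x`.
  have h7 : inner ℝ (u - p.fst) (v - u) + inner ℝ (v - q.fst) (u - v)
      = inner ℝ (p.fst - q.fst) (u - v) - ‖u - v‖ ^ 2 := by
    rw [← neg_sub u v, inner_neg_right, ← real_inner_self_eq_norm_sq (u - v)]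
    simp only [inner_sub_left]
    ring
  have h8 := real_inner_le_norm (p.fst - q.fst) (u - v)
  rcases (norm_nonneg (u - v)).eq_or_lt with h0 | h0
  · rw [← h0]
    positivity
  · refine le_of_mul_le_mul_right (?_ : ‖u - v‖ * ‖u - v‖ ≤ _) h0
    nlinarith

lemma LassoParam.norm_fst_sub_le {m : ℕ} (p q : LassoParam m) :
    ‖p.fst - q.fst‖ ≤ ‖p - q‖ :=
  WithLp.norm_fst_le _ (p - q)

lemma LassoParam.abs_snd_sub_le {m : ℕ} (p q : LassoParam m) :
    |p.snd - q.snd| ≤ ‖p - q‖ :=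
  WithLp.norm_snd_le _ (p - q)

/-- One-sided estimate between the solution sets for two parameters. -/
lemma exists_lassoSolution_near {m n : ℕ} (A : Matrix (Fin m) (Fin n) ℝ) :
    ∃ K : ℝ, 0 < K ∧ ∀ p q : LassoParam m, 0 < p.snd → 0 < q.snd → ∀ x ∈ lassoSolution A p,
      ∃ y ∈ lassoSolution A q, ‖x - y‖ ≤ K * ‖p - q‖ := by
  obtain ⟨κ, hκ, H⟩ := exists_l1_error_bound A
  obtain ⟨C, hC0, hC⟩ := exists_sum_abs_le_add_norm_mulVec_sub A
  refine ⟨n * (κ * ((1 + C) * (1 + C))) + 1, by positivity, fun p q hp hq x hx => ?_⟩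
  obtain ⟨x', hx'⟩ := lassoSolution_nonempty A hq
  have hu := norm_mulVec_sub_le_of_mem_lassoSolution hC0 hC hp hq hx hx'
  have ht := hC p hp x hx x'
  set δ := ‖p - q‖ with hδ
  have hδ0 : 0 ≤ δ := norm_nonneg _
  set e := ‖WithLp.toLp 2 (A.mulVec x.ofLp) - WithLp.toLp 2 (A.mulVec x'.ofLp)‖ with he
  have heδ : e ≤ (1 + C) * δ := by
    have h1 := LassoParam.norm_fst_sub_le p q
    have h2 := mul_le_mul_of_nonneg_left (LassoParam.abs_snd_sub_le p q) hC0
    linarith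
  have he0 : 0 ≤ e := norm_nonneg _
  have hCe : 0 ≤ C * e := by positivity
  -- `(1 + C) * e` dominates both violations: `e` in the equations and `C * e` in the `ℓ¹` bound.
  obtain ⟨y, hy, hyle, hyx⟩ := H x.ofLp x'.ofLp ((1 + C) * e) (by positivity)
    (fun j => by
      have : |A.mulVec x.ofLp j - A.mulVec x'.ofLp j| ≤ e := PiLp.norm_apply_le
        (WithLp.toLp 2 (A.mulVec x.ofLp) - WithLp.toLp 2 (A.mulVec x'.ofLp)) j
      linarith)
    (by linarith)
  refine ⟨WithLp.toLp 2 y, fun z => le_trans ?_ (hx' z), ?_⟩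
  · unfold lassoObjective
    rw [WithLp.ofLp_toLp, hy]
    have := mul_le_mul_of_nonneg_left hyle hq.le
    linarith
  · calc ‖x - WithLp.toLp 2 y‖ ≤ ∑ k, |x k - y k| := EuclideanSpace.norm_le_sum_abs _
      _ ≤ ∑ _k : Fin n, κ * ((1 + C) * e) :=
          Finset.sum_le_sum fun k _ => by rw [abs_sub_comm]; exact hyx k
      _ = n * (κ * ((1 + C) * e)) := by simp
      _ ≤ n * (κ * ((1 + C) * ((1 + C) * δ))) := by gcongr
      _ ≤ (n * (κ * ((1 + C) * (1 + C))) + 1) * δ := by linarith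

theorem theorem4p3 {m n : ℕ} (A : Matrix (Fin m) (Fin n) ℝ) :
    HausdorffLipschitzOn (lassoSolution A) {p : LassoParam m | 0 < p.snd} := by
  obtain ⟨K, hK, H⟩ := exists_lassoSolution_near A
  refine ⟨fun p hp => lassoSolution_nonempty A hp, K, hK, fun p hp q hq => ?_⟩
  have hedist : ∀ {p q : LassoParam m}, 0 < p.snd → 0 < q.snd → ∀ x ∈ lassoSolution A p,
      ∃ y ∈ lassoSolution A q, edist x y ≤ ENNReal.ofReal (K * ‖p - q‖) := by
    intro p q hp hq x hx
    obtain ⟨y, hy, hxy⟩ := H p q hp hq x hx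
    exact ⟨y, hy, by rw [edist_dist, dist_eq_norm]; exact ENNReal.ofReal_le_ofReal hxy⟩
  refine Metric.hausdorffEDist_le_of_mem_edist (hedist hp hq) ?_
  rw [norm_sub_rev]
  exact hedist hq hp
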